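/- All sets are finite. For integers $0\le t\le k\le v$ and $\lambda\ge1$, a $t$-$(v,k,\lambda)$ covering is a pair $(V,\mathcal B)$ where $|V|=v$ and $\mathcal B$ is a multiset of $k$-subsets of $V$ (blocks) such that each $t$-subset of $V$ is contained in at least $\lambda$ blocks, counted with multiplicity. Let $C_\lambda(v,k,t)$ be the minimum number of blocks in a $t$-$(v,k,\lambda)$ covering (so $C_\lambda(v,k,0)=\lambda$), and define $L_\lambda(v,k,0)=\lambda$ and $L_\lambda(v,k,t)=\lceil \frac vk L_\lambda(v-1,k-1,t-1)\rceil$ for $t\ge 1$. **Theorem 6.3.** Let $t,v,k,\lambda,s$ be positive integers with $t<k<v$ and $s\le\lfloor t/2\rfloor$. Let $b_s,b_{s+1},\ldots,b_{2s}$ be positive integers such that (i) $L_\lambda(v-2s,k-2s,t-2s)\le b_{2s}\le C_\lambda(v-2s,k-2s,t-2s)$; (ii) $\lceil\frac{v-i}{k-i}b_{i+1}\rceil\le b_i\le C_\lambda(v-i,k-i,t-i)$ for $i=s,\ldots,2s-1$; and (iii) $a_j\ge0$ for $j\in\{0,\ldots,s\}$, where $a_j=\sum_{i=0}^{j}(-1)^{i+j}\binom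 ji b_{2s-i}$. Let $$d=b_s\left(\tbinom ks-1\right)-\sum_{i=0}^{s-1}\tbinom si\tbinom{v-s}{s-i}b_{2s-i},\qquad d'=d+\tbinom ks-1,$$ and, for real $\alpha,\beta$, let $$CB(\alpha,\beta)=\frac{b_s(\alpha-\beta)\binom vs+\alpha\binom vs}{(\alpha-\beta)\binom ks+1}.$$ Suppose that $b_s<\binom ks$ and $d<a_s$. Then $C_\lambda(v,k,t)\ge\lceil CB(\alpha,\beta)\rceil$ whenever one of the following holds. (a) $(\alpha,\beta)=\left(1-\frac{d^2}{2a_s(a_s+1)},\ \frac{a_s+2}{2(d'+1)}\right)$. (b) $(\alpha,\beta)=\left(1,\ 1-\frac{dd'}{a_s(a_s+1)}\right)$, $d\ge\frac{a_s}2$ and $dd'<a_s(a_s+1)$. (c) $(\alpha,\beta)=\left(1,\ \sqrt{\frac{d(a_s+2)}{(a_s+1)(a_s-d)}}-\frac{d(d'+1)}{2(a_s+1)(a_s-d)}\right)$, $d<\frac{a_s}2$ and $d(d'+1)^2<4(a_s+1)(a_s+2)(a_s-d)$. -/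

import Mathlib

noncomputable section

/-- `b(X)`: the number of blocks, counted with multiplicity, that contain `X`. -/
def blockCount {V : Type*} [DecidableEq V] (B : Multiset (Finset V)) (X : Finset V) : ℕ :=
  B.countP (fun Y => X ⊆ Y)

/-- `(V, B)` is a `t`-`(v,k,l)` covering; `B` is a multiset of blocks. -/
structure IsCovering {V : Type*} [Fintype V] [DecidableEq V]
    (B : Multiset (Finset V)) (t v k l : ℕ) : Prop where
  card_points : Fintype.card V = v
  card_block : ∀ Y ∈ B, Y.card = k
  covers : ∀ T : Finset V, T.card = t → l ≤ blockCount B T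

/-- The covering number `C_l(v,k,t)`: the least number of blocks in a `t`-`(v,k,l)` covering, with
the convention `C_l(v,k,0) = l`. Every `v`-set can be taken to be `Fin v`; for `1 ≤ t ≤ k ≤ v`
coverings exist, so the infimum is an attained minimum. -/
def coveringNumber (l v k t : ℕ) : ℕ :=
  if t = 0 then l
  else sInf {n : ℕ | ∃ B : Multiset (Finset (Fin v)), IsCovering B t v k l ∧ Multiset.card B = n}

/-- The Schönheim bound `L_l(v,k,t) = ⌈v/k ⌈(v-1)/(k-1) ⋯ ⌈l(v-t+1)/(k-t+1)⌉ ⋯ ⌉⌉`, with the empty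
nesting `L_l(v,k,0) = l`. -/
def schonheim (l : ℕ) : ℕ → ℕ → ℕ → ℕ
  | _, _, 0 => l
  | v, k, t + 1 => ⌈(v : ℚ) / (k : ℚ) * (schonheim l (v - 1) (k - 1) t : ℚ)⌉₊

/-- `a_j = ∑_{i=0}^{j} (-1)^{i+j} (j choose i) b_{2s-i}`. -/
def aCoeff (s : ℕ) (b : ℕ → ℕ) (j : ℕ) : ℤ :=
  ∑ i ∈ Finset.range (j + 1), (-1 : ℤ) ^ (i + j) * (j.choose i : ℤ) * (b (2 * s - i) : ℤ)

/-- `d = b_s ((k choose s) - 1) - ∑_{i=0}^{s-1} (s choose i) (v-s choose s-i) b_{2s-i}`. -/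
def dParam (v k s : ℕ) (b : ℕ → ℕ) : ℤ :=
  (b s : ℤ) * ((k.choose s : ℤ) - 1) -
    ∑ i ∈ Finset.range s,
      (s.choose i : ℤ) * ((v - s).choose (s - i) : ℤ) * (b (2 * s - i) : ℤ)

/-- The standing hypotheses on the parameters and on the integers `b_s, …, b_{2s}`. Only the values
of `b` on `{s, …, 2s}` matter. No subtraction truncates, as `2s ≤ t < k < v`. -/
structure SetUp (t v k l s : ℕ) (b : ℕ → ℕ) : Prop where
  t_pos : 0 < t
  l_pos : 0 < l
  s_pos : 0 < s
  t_lt_k : t < k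
  k_lt_v : k < v
  s_le : s ≤ t / 2
  b_pos : ∀ i, s ≤ i → i ≤ 2 * s → 0 < b i
  top_lower : schonheim l (v - 2 * s) (k - 2 * s) (t - 2 * s) ≤ b (2 * s)
  top_upper : b (2 * s) ≤ coveringNumber l (v - 2 * s) (k - 2 * s) (t - 2 * s)
  step_lower : ∀ i, s ≤ i → i < 2 * s →
    ⌈((v - i : ℕ) : ℚ) / ((k - i : ℕ) : ℚ) * (b (i + 1) : ℚ)⌉₊ ≤ b i
  step_upper : ∀ i, s ≤ i → i < 2 * s → b i ≤ coveringNumber l (v - i) (k - i) (t - i)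
  a_nonneg : ∀ j, j ≤ s → 0 ≤ aCoeff s b j

/-- `CB_{(v,k,l;s)}(α,β)`, where `bs` stands for `b_s`. -/
def CB (v k s bs : ℕ) (α β : ℝ) : ℝ :=
  ((bs : ℝ) * (α - β) * (v.choose s : ℝ) + α * (v.choose s : ℝ)) /
    ((α - β) * (k.choose s : ℝ) + 1)

end

/-! For a covering B let r(X) be the number of blocks containing X. The matrix r(X ∪ Z) indexed by
s-sets is a Gram matrix of incidence vectors of length |B|, so |B| ≥ |S| whenever its principal
submatrix on S is positive definite (`card_le_card_blocks`). Write r(X ∪ Z) as b_{|X ∪ Z|}, plus a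
nonnegative off-diagonal excess, plus the diagonal r(X) - b_s. The first part dominates a_s I
(`aCoeff_mul_sum_sq_le`). The excess, read as a multigraph on the s-sets, has degree d at the sets
V₀ with r = b_s and d' at the sets V₁ with r = b_s + 1 (`SetUp.sum_excess`).

Weighting V₀ by slightly more than d/a_s and T ⊆ V₁ by 1, diagonal dominance gives |V₀| + |T| ≤ |B|
as soon as deg_T + (d/a_s) deg_{V₀} < a_s + 1 throughout T (`SetUp.card_add_card_le`). Deleting
vertices from V₁ while a potential does not decrease yields a large such T: a linear potential
serves (b), the Caro–Tuza weight serves (a) and (c). Hence α|V₀| + β|V₁| ≤ |B|. All other s-sets lie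
in at least b_s + 2 blocks, and counting pairs (s-set, block) turns this into the bound CB
(`CB_le`). -/

/-! ### The Caro–Tuza weight -/

/-- The Caro–Tuza weight function for induced subgraphs of maximum degree less than `j`. -/
noncomputable def caroTuza (j x : ℝ) : ℝ :=
  if x ≤ j then 1 - x / (2 * j) else (j + 1) / (2 * (x + 1))

theorem caroTuza_of_le {j x : ℝ} (h : x ≤ j) : caroTuza j x = 1 - x / (2 * j) := if_pos h

theorem caroTuza_of_ge {j x : ℝ} (hj : 1 ≤ j) (h : j ≤ x) :
    caroTuza j x = (j + 1) / (2 * (x + 1)) := by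
  rcases h.eq_or_lt with rfl | h
  · rw [caroTuza_of_le le_rfl]
    field_simp
    ring
  · exact if_neg h.not_ge

theorem caroTuza_le_one {j x : ℝ} (hj : 1 ≤ j) (hx : 0 ≤ x) : caroTuza j x ≤ 1 := by
  rcases le_total x j with h | h
  · rw [caroTuza_of_le h]
    have : 0 ≤ x / (2 * j) := by positivity
    linarith
  · rw [caroTuza_of_ge hj h, div_le_one (by positivity)]
    linarith

theorem caroTuza_antitone {j : ℝ} (hj : 1 ≤ j) : Antitone (caroTuza j) := by
  intro x y hxy
  have key : ∀ {x y : ℝ}, x ≤ y → y ≤ j → caroTuza j y ≤ caroTuza j x := by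
    intro x y hxy hy
    rw [caroTuza_of_le hy, caroTuza_of_le (hxy.trans hy)]
    gcongr
  have key' : ∀ {x y : ℝ}, x ≤ y → j ≤ x → caroTuza j y ≤ caroTuza j x := by
    intro x y hxy hx
    rw [caroTuza_of_ge hj hx, caroTuza_of_ge hj (hx.trans hxy)]
    have : 0 < x + 1 := by linarith
    gcongr
  rcases le_total y j with hy | hy
  · exact key hxy hy
  · rcases le_total x j with hx | hx
    · exact (key' hy le_rfl).trans (key hx le_rfl)
    · exact key' hxy hx

/-- By convexity the unit drop is smallest at the right end w = D. The bound is the drop of the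
hyperbola there, which is 1/D times the weight at D: what is lost by deleting a vertex of degree D
is repaid along its D edges. -/
theorem caroTuza_step {j w D : ℝ} (hj : 1 ≤ j) (hD : j ≤ D) (hw : w ≤ D) :
    (j + 1) / (2 * D * (D + 1)) ≤ caroTuza j (w - 1) - caroTuza j w := by
  have hD0 : 0 < D := by linarith
  rcases le_or_gt w j with h | h
  · rw [caroTuza_of_le h, caroTuza_of_le (by linarith)]
    have : 1 - (w - 1) / (2 * j) - (1 - w / (2 * j)) = 1 / (2 * j) := by
      field_simp
      ring
    rw [this, div_le_div_iff₀ (by positivity) (by positivity)]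
    nlinarith [mul_le_mul hD hD (by linarith) hD0.le]
  · have hw0 : 0 < w := by linarith
    have h1 : (j + 1) / (2 * D * (D + 1)) ≤ (j + 1) / (2 * w * (w + 1)) := by
      gcongr
    have h2 : (j + 1) / (2 * w * (w + 1)) = (j + 1) / (2 * w) - (j + 1) / (2 * (w + 1)) := by
      field_simp
      ring
    -- The line lies above the hyperbola between their common points j - 1 and j.
    have h3 : (j + 1) / (2 * w) ≤ caroTuza j (w - 1) := by
      rcases le_total (w - 1) j with h' | h'
      · rw [caroTuza_of_le h', div_le_iff₀ (by positivity)]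
        have : (1 - (w - 1) / (2 * j)) * (2 * w) = (2 * j - (w - 1)) * w / j := by
          field_simp
        rw [this, le_div_iff₀ (by positivity)]
        nlinarith
      · rw [caroTuza_of_ge hj h', sub_add_cancel]
    rw [caroTuza_of_ge hj h.le]
    linarith

theorem caroTuza_nat_step {j w D : ℝ} (hj : 1 ≤ j) (hD : j ≤ D) (hw : w ≤ D) (m : ℕ) :
    m * ((j + 1) / (2 * D * (D + 1))) ≤ caroTuza j (w - m) - caroTuza j w := by
  induction m with
  | zero => simp
  | succ m ih =>
    have h := caroTuza_step hj hD (w := w - m)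
      (by have : (0 : ℝ) ≤ m := m.cast_nonneg
          linarith)
    rw [show w - ((m + 1 : ℕ) : ℝ) = w - m - 1 by push_cast; ring]
    push_cast
    linarith

/-! ### Vertex deletion and diagonal dominance -/

theorem Finset.exists_subset_of_erase {ι : Type*} [DecidableEq ι] (Φ : Finset ι → ℝ)
    (good : Finset ι → Prop) (V : Finset ι)
    (h : ∀ T ⊆ V, ¬ good T → ∃ x ∈ T, Φ T ≤ Φ (T.erase x)) :
    ∃ T ⊆ V, good T ∧ Φ V ≤ Φ T := by
  induction V using Finset.strongInduction with
  | H V ih =>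
    by_cases hg : good V
    · exact ⟨V, subset_rfl, hg, le_rfl⟩
    · obtain ⟨x, hx, hle⟩ := h V subset_rfl hg
      obtain ⟨T, hT, hgT, hΦ⟩ := ih _ (erase_ssubset hx)
        fun T hT => h T (hT.trans (erase_subset _ _))
      exact ⟨T, hT.trans (erase_subset _ _), hgT, hle.trans hΦ⟩

section Deletion

variable {ι : Type*} (E : ι → ι → ℕ)

/-- The number of edges from `x` to `T` in the multigraph with edge multiplicities `E`. -/
def degIn (x : ι) (T : Finset ι) : ℝ := ∑ z ∈ T, (E x z : ℝ)

theorem degIn_nonneg (x : ι) (T : Finset ι) : 0 ≤ degIn E x T :=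
  Finset.sum_nonneg fun _ _ => Nat.cast_nonneg _

/-- A weighted diagonally dominant quadratic form is positive definite. -/
theorem eq_zero_of_dominant (hsymm : ∀ x y, E x y = E y x) (S : Finset ι) (D y : ι → ℝ)
    (hy : ∀ i ∈ S, 0 < y i) (hdom : ∀ i ∈ S, ∑ j ∈ S, (E i j : ℝ) * y j < D i * y i)
    (x : ι → ℝ)
    (hx : ∑ i ∈ S, D i * x i ^ 2 + ∑ i ∈ S, ∑ j ∈ S, (E i j : ℝ) * (x i * x j) ≤ 0) :
    ∀ i ∈ S, x i = 0 := by
  set G : ι → ι → ℝ := fun i j => (E i j : ℝ) * (x i ^ 2 * y j / y i) with hG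
  -- AM-GM in the coordinates x/y moves the off-diagonal terms to the diagonal, where row i receives
  -- its weighted row sum.
  have h1 : ∀ i ∈ S, ∀ j ∈ S, -(1 / 2) * (G i j + G j i) ≤ (E i j : ℝ) * (x i * x j) := by
    intro i hi j hj
    have hyi := hy i hi
    have hyj := hy j hj
    have hE : (0 : ℝ) ≤ E i j := Nat.cast_nonneg _
    simp only [hG, hsymm j i]
    have : 0 ≤ x i ^ 2 * y j / y i + x j ^ 2 * y i / y j + 2 * (x i * x j) := by
      have : x i ^ 2 * y j / y i + x j ^ 2 * y i / y j + 2 * (x i * x j) =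
          (x i * y j + x j * y i) ^ 2 / (y i * y j) := by
        field_simp
        ring
      rw [this]
      positivity
    nlinarith
  have h2 := Finset.sum_le_sum fun i hi => Finset.sum_le_sum (h1 i hi)
  have h3 : ∑ i ∈ S, ∑ j ∈ S, -(1 / 2) * (G i j + G j i) = -∑ i ∈ S, ∑ j ∈ S, G i j := by
    simp only [← Finset.mul_sum, Finset.sum_add_distrib]
    rw [Finset.sum_comm (f := fun i j => G j i)]
    ring
  have h4 : ∑ i ∈ S, (D i * x i ^ 2 - ∑ j ∈ S, G i j) ≤ 0 := by
    rw [Finset.sum_sub_distrib]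
    linarith
  have h5 : ∀ i ∈ S, D i * x i ^ 2 - ∑ j ∈ S, G i j =
      x i ^ 2 * ((D i * y i - ∑ j ∈ S, (E i j : ℝ) * y j) / y i) := by
    intro i hi
    have hyi := hy i hi
    have : ∑ j ∈ S, G i j = x i ^ 2 / y i * ∑ j ∈ S, (E i j : ℝ) * y j := by
      rw [Finset.mul_sum]
      refine Finset.sum_congr rfl fun j _ => ?_
      simp only [hG]
      ring
    rw [this]
    field_simp
  have hpos : ∀ i ∈ S, 0 < (D i * y i - ∑ j ∈ S, (E i j : ℝ) * y j) / y i := fun i hi =>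
    div_pos (sub_pos.2 (hdom i hi)) (hy i hi)
  have h6 : ∀ i ∈ S, 0 ≤ D i * x i ^ 2 - ∑ j ∈ S, G i j := fun i hi => by
    rw [h5 i hi]
    exact mul_nonneg (sq_nonneg _) (hpos i hi).le
  intro i hi
  have h7 := (Finset.sum_eq_zero_iff_of_nonneg h6).1 (le_antisymm h4 (Finset.sum_nonneg h6)) i hi
  rw [h5 i hi] at h7
  rcases mul_eq_zero.1 h7 with h | h
  · exact pow_eq_zero_iff (two_ne_zero) |>.1 h
  · exact absurd h (hpos i hi).ne'

variable [DecidableEq ι]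

theorem degIn_erase {x y : ι} {T : Finset ι} (hy : y ∈ T) :
    degIn E x (T.erase y) = degIn E x T - E x y := by
  simp only [degIn]
  rw [← Finset.add_sum_erase T _ hy]
  ring

theorem degIn_self_erase (h0 : ∀ x, E x x = 0) {x : ι} {T : Finset ι} (hx : x ∈ T) :
    degIn E x (T.erase x) = degIn E x T := by
  rw [degIn_erase E hx, h0]
  simp

/-- Deletion with a linear potential. -/
theorem exists_sparse_linear (hsymm : ∀ x y, E x y = E y x) (h0 : ∀ x, E x x = 0)
    (V₀ V₁ : Finset ι) {a d d' : ℝ} (ha : 0 < a) (hd : a / 2 ≤ d)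
    (hV₁ : ∀ x ∈ V₁, degIn E x V₀ + degIn E x V₁ ≤ d') :
    ∃ T ⊆ V₁, (∀ x ∈ T, degIn E x T + d / a * degIn E x V₀ < a + 1) ∧
      (V₁.card : ℝ) * (1 - d * d' / (a * (a + 1))) ≤ T.card := by
  -- Deleting x costs 1 and returns κ (deg_{V₀} x + 2 deg_T x), edges inside T being counted at both
  -- ends. For a bad x this is at least 1, because 1/(a + 1) ≤ 2κ exactly when d ≥ a/2.
  set κ : ℝ := d / (a * (a + 1)) with hκ
  have hκ0 : 0 ≤ κ := div_nonneg (by linarith) (by positivity)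
  obtain ⟨T, hT, hg, hΦ⟩ := Finset.exists_subset_of_erase
    (fun T => (T.card : ℝ) - κ * ∑ x ∈ T, (degIn E x V₀ + degIn E x T))
    (fun T => ∀ x ∈ T, degIn E x T + d / a * degIn E x V₀ < a + 1) V₁ (by
      intro T _ hbad
      push Not at hbad
      obtain ⟨x, hx, hle⟩ := hbad
      refine ⟨x, hx, ?_⟩
      have h1 : ∑ z ∈ T.erase x, (degIn E z V₀ + degIn E z (T.erase x)) =
          ∑ z ∈ T.erase x, (degIn E z V₀ + degIn E z T) - degIn E x T := by
        rw [← degIn_self_erase E h0 hx]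
        simp only [degIn]
        rw [← Finset.sum_sub_distrib]
        refine Finset.sum_congr rfl fun z _ => ?_
        have := degIn_erase E (x := z) hx
        simp only [degIn] at this
        rw [this, hsymm x z]
        ring
      have h2 := Finset.add_sum_erase T (fun z => degIn E z V₀ + degIn E z T) hx
      rw [h1, ← h2, Finset.card_erase_of_mem hx,
        Nat.cast_sub (Finset.card_pos.2 ⟨x, hx⟩), Nat.cast_one]
      have h3 : 1 ≤ (degIn E x T + d / a * degIn E x V₀) / (a + 1) := by
        rwa [le_div_iff₀ (by positivity), one_mul]
      have h4 : (degIn E x T + d / a * degIn E x V₀) / (a + 1) =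
          1 / (a + 1) * degIn E x T + κ * degIn E x V₀ := by
        rw [hκ]
        field_simp
      have h5 : 1 / (a + 1) ≤ 2 * κ := by
        rw [hκ, ← mul_div_assoc, div_le_div_iff₀ (by positivity) (by positivity)]
        nlinarith
      have h6 := mul_le_mul_of_nonneg_right h5 (degIn_nonneg E x T)
      linarith)
  refine ⟨T, hT, hg, ?_⟩
  have h1 : ∑ x ∈ V₁, (degIn E x V₀ + degIn E x V₁) ≤ V₁.card * d' := by
    simpa using Finset.sum_le_sum hV₁
  have h2 : 0 ≤ ∑ x ∈ T, (degIn E x V₀ + degIn E x T) :=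
    Finset.sum_nonneg fun x _ => add_nonneg (degIn_nonneg ..) (degIn_nonneg ..)
  have h3 := mul_le_mul_of_nonneg_left h1 hκ0
  have h4 := mul_nonneg hκ0 h2
  have h5 : d * d' / (a * (a + 1)) = κ * d' := by
    rw [hκ]
    ring
  rw [h5]
  linarith

/-- Deletion with the Caro–Tuza potential. -/
theorem exists_sparse_caroTuza (hsymm : ∀ x y, E x y = E y x) (h0 : ∀ x, E x x = 0)
    (V₀ V₁ : Finset ι) {a d : ℝ} (ha : 0 < a) (hd : 0 ≤ d) :
    ∃ T ⊆ V₁, (∀ x ∈ T, degIn E x T + d / a * degIn E x V₀ < a + 1) ∧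
      ∑ x ∈ V₁, (caroTuza (a + 1) (degIn E x V₁ + d / a * degIn E x V₀)
        - d / (2 * a * (a + 1)) * degIn E x V₀) ≤ T.card := by
  have hc : 0 ≤ d / a := by positivity
  have hκ : 0 ≤ d / (2 * a * (a + 1)) := by positivity
  have hj : 1 ≤ a + 1 := by linarith
  obtain ⟨T, hT, hg, hΦ⟩ := Finset.exists_subset_of_erase
    (fun T => ∑ x ∈ T, (caroTuza (a + 1) (degIn E x T + d / a * degIn E x V₀)
        - d / (2 * a * (a + 1)) * degIn E x V₀))
    (fun T => ∀ x ∈ T, degIn E x T + d / a * degIn E x V₀ < a + 1) V₁ (by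
      intro T _ hbad
      push Not at hbad
      obtain ⟨y, hy, hle⟩ := hbad
      -- Maximality lets `caroTuza_nat_step` apply with one `D` to all of `T`.
      obtain ⟨x, hx, hmax⟩ := T.exists_max_image
        (fun x => degIn E x T + d / a * degIn E x V₀) ⟨y, hy⟩
      refine ⟨x, hx, ?_⟩
      set D := degIn E x T + d / a * degIn E x V₀ with hD
      have hjD : a + 1 ≤ D := hle.trans (hmax y hy)
      have hD0 : 0 < D := by linarith
      set δ : ℝ := (a + 1 + 1) / (2 * D * (D + 1)) with hδ
      rw [← Finset.add_sum_erase T _ hx]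
      have h1 : ∀ z ∈ T.erase x,
          (caroTuza (a + 1) (degIn E z T + d / a * degIn E z V₀)
            - d / (2 * a * (a + 1)) * degIn E z V₀) + E x z * δ ≤
          caroTuza (a + 1) (degIn E z (T.erase x) + d / a * degIn E z V₀)
            - d / (2 * a * (a + 1)) * degIn E z V₀ := by
        intro z hz
        have := caroTuza_nat_step hj hjD (hmax z (Finset.mem_of_mem_erase hz)) (E x z)
        rw [degIn_erase E hx, hsymm z x,
          show degIn E z T - E x z + d / a * degIn E z V₀ =
            degIn E z T + d / a * degIn E z V₀ - E x z by ring]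
        linarith
      have h2 := Finset.sum_le_sum h1
      rw [Finset.sum_add_distrib, ← Finset.sum_mul] at h2
      have h3 : ∑ z ∈ T.erase x, (E x z : ℝ) = degIn E x T := degIn_self_erase E h0 hx
      rw [h3] at h2
      -- Deletion loses D δ, but only edges inside `T` repay δ each; the share due to V₀ is covered
      -- by the penalty term that disappears with x.
      have h4 : caroTuza (a + 1) D = D * δ := by
        rw [caroTuza_of_ge hj hjD, hδ]
        field_simp
      have h5 : d / a * δ ≤ d / (2 * a * (a + 1)) := by
        have : δ ≤ 1 / (2 * (a + 1)) := by
          rw [hδ, div_le_div_iff₀ (by positivity) (by positivity)]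
          nlinarith [mul_le_mul hjD hjD (by linarith) hD0.le]
        calc d / a * δ ≤ d / a * (1 / (2 * (a + 1))) := by gcongr
          _ = _ := by field_simp
      have h6 := mul_le_mul_of_nonneg_right h5 (degIn_nonneg E x V₀)
      have h7 : D * δ = degIn E x T * δ + d / a * δ * degIn E x V₀ := by
        rw [hD]
        ring
      linarith)
  refine ⟨T, hT, hg, hΦ.trans ?_⟩
  have : ∀ x ∈ T, caroTuza (a + 1) (degIn E x T + d / a * degIn E x V₀)
        - d / (2 * a * (a + 1)) * degIn E x V₀ ≤ 1 := by
    intro x _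
    have h1 := degIn_nonneg E x V₀
    have h2 := caroTuza_le_one hj (add_nonneg (degIn_nonneg E x T) (mul_nonneg hc h1))
    have h3 := mul_nonneg hκ h1
    linarith
  simpa using Finset.sum_le_sum this

/-- The hyperbola and the line of the Caro–Tuza weight both lie above the tangent bound. -/
theorem caroTuza_sub_ge {a d d' e y : ℝ} (ha : 0 < a) (hd : 0 ≤ d) (hda : d < a / 2)
    (hy : 0 ≤ y) (he : 0 ≤ e) (hey : y + e ≤ d') :
    Real.sqrt (d * (a + 2) / ((a + 1) * (a - d))) - d * (d' + 1) / (2 * (a + 1) * (a - d)) ≤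
      caroTuza (a + 1) (e + d / a * y) - d / (2 * a * (a + 1)) * y := by
  have had : 0 < a - d := by linarith
  -- Eliminating y through y + e ≤ d' bounds the penalty by c (d' - w). What remains is to minimise
  -- the weight plus c (w + 1), which on the hyperbola is AM-GM.
  set c : ℝ := d / (2 * (a + 1) * (a - d)) with hc
  have hc0 : 0 ≤ c := by positivity
  set w := e + d / a * y with hw
  have hw0 : 0 ≤ w := by positivity
  have h1 : d / (2 * a * (a + 1)) * y ≤ c * (d' - w) := by
    have : d / (2 * a * (a + 1)) * y = c * ((y + e) - w) := by
      rw [hc, hw]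
      field_simp
      ring
    rw [this]
    gcongr
  have amgm : ∀ u : ℝ, 0 < u →
      Real.sqrt (d * (a + 2) / ((a + 1) * (a - d))) ≤ (a + 2) / (2 * u) + c * u := by
    intro u hu
    apply Real.sqrt_le_iff.2
    refine ⟨by positivity, ?_⟩
    have h : d * (a + 2) / ((a + 1) * (a - d)) = 4 * ((a + 2) / (2 * u) * (c * u)) := by
      rw [hc]
      field_simp
      ring
    rw [h]
    nlinarith [sq_nonneg ((a + 2) / (2 * u) - c * u)]
  have h2 : d * (d' + 1) / (2 * (a + 1) * (a - d)) = c * (d' + 1) := by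
    rw [hc]
    ring
  rw [h2]
  rcases le_total (a + 1) w with h | h
  · rw [caroTuza_of_ge (by linarith) h]
    have := amgm (w + 1) (by linarith)
    rw [show a + 1 + 1 = a + 2 by ring]
    linarith
  · rw [caroTuza_of_le h]
    have h3 := amgm (a + 1 + 1) (by linarith)
    have h4 : (a + 2) / (2 * (a + 1 + 1)) = 1 / 2 := by
      field_simp
      ring
    rw [h4] at h3
    -- As d < a/2, the line falls at least as fast as c w grows, so its minimum is at the break w =
    -- a + 1, a point of the hyperbola.
    have h5 : c ≤ 1 / (2 * (a + 1)) := by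
      rw [hc, div_le_div_iff₀ (by positivity) (by positivity)]
      nlinarith
    have h6 : w / (2 * (a + 1)) = 1 / 2 - (a + 1 - w) * (1 / (2 * (a + 1))) := by
      field_simp
      ring
    have h7 := mul_le_mul_of_nonneg_left h5 (sub_nonneg.2 h)
    rw [h6]
    linarith

end Deletion

/-! ### Block counts, derived coverings and quadratic forms -/

section Coverings

open Finset

theorem blockCount_eq_sum {V : Type*} [DecidableEq V] (B : Multiset (Finset V)) (Z : Finset V) :
    blockCount B Z = ∑ y : B, if Z ⊆ y.1 then 1 else 0 := by
  rw [← card_filter, blockCount]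
  conv_lhs => rw [← B.map_univ_coe]
  rw [Multiset.countP_map]
  rfl

theorem blockCount_empty {V : Type*} [DecidableEq V] (B : Multiset (Finset V)) :
    blockCount B ∅ = Multiset.card B := by
  simp [blockCount]

/-- Double counting of pairs: a block through X and an s-set Z inside it. -/
theorem sum_blockCount_union {V : Type*} [Fintype V] [DecidableEq V] (B : Multiset (Finset V))
    {k : ℕ} (hB : ∀ Y ∈ B, Y.card = k) (s : ℕ) (X : Finset V) :
    ∑ Z ∈ powersetCard s univ, blockCount B (X ∪ Z) = blockCount B X * k.choose s := by
  simp only [blockCount_eq_sum, sum_mul]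
  rw [sum_comm]
  refine sum_congr rfl fun y _ => ?_
  have hy : #y.1 = k := hB _ (Multiset.coe_mem)
  by_cases hX : X ⊆ y.1
  · simp only [union_subset_iff, hX, true_and, if_true, one_mul]
    rw [← card_filter, ← hy, ← card_powersetCard]
    congr 1
    ext Z
    simp [mem_powersetCard, and_comm]
  · simp [union_subset_iff, hX]

theorem card_filter_inter {V : Type*} [Fintype V] [DecidableEq V] (X : Finset V) {s i : ℕ}
    (hi : i ≤ s) :
    #{Z ∈ powersetCard s univ | #(X ∩ Z) = i} =
      (#X).choose i * (Fintype.card V - #X).choose (s - i) := by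
  rw [← card_compl, ← card_powersetCard, ← card_powersetCard, ← card_product]
  have hsplit : ∀ Z : Finset V, #Z = #(X ∩ Z) + #(Xᶜ ∩ Z) := fun Z => by
    rw [← card_union_of_disjoint]
    · rw [← union_inter_distrib_right, union_compl, univ_inter]
    · exact disjoint_compl_right.mono inter_subset_left inter_subset_left
  refine card_bij' (fun Z _ => (X ∩ Z, Xᶜ ∩ Z)) (fun P _ => P.1 ∪ P.2) ?_ ?_ ?_ ?_
  · intro Z hZ
    simp only [mem_filter, mem_powersetCard, subset_univ, true_and] at hZ
    have := hsplit Z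
    simp only [mem_product, mem_powersetCard, inter_subset_left, true_and]
    omega
  · rintro ⟨P, Q⟩ hP
    simp only [mem_product, mem_powersetCard] at hP
    obtain ⟨⟨hP, hPc⟩, hQ, hQc⟩ := hP
    have hd : Disjoint P Q := disjoint_compl_right.mono hP hQ
    have h1 : X ∩ (P ∪ Q) = P := by
      rw [inter_union_distrib_left, inter_eq_right.2 hP,
        disjoint_iff_inter_eq_empty.1 (disjoint_compl_right.mono_right hQ), union_empty]
    simp only [mem_filter, mem_powersetCard, subset_univ, true_and, h1, hPc,
      card_union_of_disjoint hd, hQc]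
    simp [hi]
  · intro Z _
    simp only
    rw [← union_inter_distrib_right, union_compl, univ_inter]
  · rintro ⟨P, Q⟩ hP
    simp only [mem_product, mem_powersetCard] at hP
    obtain ⟨⟨hP, hPc⟩, hQ, hQc⟩ := hP
    simp only [Prod.mk.injEq]
    constructor
    · rw [inter_union_distrib_left, inter_eq_right.2 hP,
        disjoint_iff_inter_eq_empty.1 (disjoint_compl_right.mono_right hQ), union_empty]
    · rw [inter_union_distrib_left, inter_eq_right.2 hQ,
        disjoint_iff_inter_eq_empty.1 (disjoint_compl_left.mono_right hP), empty_union]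

theorem sum_comp_card_inter {V : Type*} [Fintype V] [DecidableEq V] (X : Finset V) (s : ℕ)
    (g : ℕ → ℕ) :
    ∑ Z ∈ powersetCard s univ, g #(X ∩ Z) =
      ∑ i ∈ range (s + 1), (#X).choose i * (Fintype.card V - #X).choose (s - i) * g i := by
  rw [← sum_fiberwise_of_maps_to (t := range (s + 1)) (g := fun Z => #(X ∩ Z))]
  · refine sum_congr rfl fun i hi => ?_
    rw [← card_filter_inter X (Nat.lt_succ_iff.1 (mem_range.1 hi)), card_eq_sum_ones, sum_mul]
    exact sum_congr rfl fun Z hZ => by rw [(mem_filter.1 hZ).2, one_mul]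
  · intro Z hZ
    rw [mem_range, Nat.lt_succ_iff, ← (mem_powersetCard.1 hZ).2]
    exact card_le_card inter_subset_right

/-- a_j is the j-th forward difference at 0 of i ↦ b_{2s-i}, so this is Newton's formula. -/
theorem sum_choose_mul_aCoeff (s : ℕ) (b : ℕ → ℕ) (i : ℕ) :
    (b (2 * s - i) : ℤ) = ∑ j ∈ range (i + 1), (i.choose j : ℤ) * aCoeff s b j := by
  have h := shift_eq_sum_fwdDiff_iter 1 (fun i : ℕ => (b (2 * s - i) : ℤ)) i 0
  simp only [smul_eq_mul, mul_one, zero_add] at h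
  rw [h]
  refine sum_congr rfl fun j _ => ?_
  rw [fwdDiff_iter_eq_sum_shift, nsmul_eq_mul]
  congr 1
  refine sum_congr rfl fun m hm => ?_
  have hm' : m ≤ j := Nat.lt_succ_iff.1 (mem_range.1 hm)
  have : (-1 : ℤ) ^ (m + j) = (-1) ^ (j - m) := by
    rw [show m + j = (j - m) + 2 * m by omega, pow_add, pow_mul]
    simp
  simp [this]

/-- The quadratic form with entries `b (|X ∪ Z|)` dominates `a_s` times the identity. -/
theorem aCoeff_mul_sum_sq_le {V : Type*} [Fintype V] [DecidableEq V] {s : ℕ} (b : ℕ → ℕ)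
    (ha : ∀ j ≤ s, 0 ≤ aCoeff s b j) (S : Finset (Finset V)) (hS : ∀ X ∈ S, #X = s)
    (x : Finset V → ℝ) :
    (aCoeff s b s : ℝ) * ∑ X ∈ S, x X ^ 2 ≤
      ∑ X ∈ S, ∑ Z ∈ S, (b #(X ∪ Z) : ℝ) * (x X * x Z) := by
  -- The number of common j-subsets J of X and Z is binom(|X ∩ Z|, j), so each j contributes a_j
  -- times a sum of squares.
  have key : ∀ X ∈ S, ∀ Z ∈ S, (b #(X ∪ Z) : ℝ) =
      ∑ j ∈ range (s + 1), (aCoeff s b j : ℝ) *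
        ∑ J ∈ powersetCard j (univ : Finset V), if J ⊆ X ∧ J ⊆ Z then 1 else 0 := by
    intro X hX Z hZ
    have hXZ : #(X ∪ Z) = 2 * s - #(X ∩ Z) := by
      have := card_union_add_card_inter X Z
      have := hS X hX
      have := hS Z hZ
      omega
    have hle : #(X ∩ Z) ≤ s := hS X hX ▸ card_le_card inter_subset_left
    have h := sum_choose_mul_aCoeff s b #(X ∩ Z)
    rw [hXZ, ← Int.cast_natCast (R := ℝ), h, Int.cast_sum]
    rw [← sum_subset (range_subset_range.2 (Nat.succ_le_succ hle))]
    · refine sum_congr rfl fun j _ => ?_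
      rw [← sum_filter, sum_const, Int.cast_mul, mul_comm, nsmul_eq_mul, mul_one]
      congr 2
      rw [← card_powersetCard]
      congr 2
      ext J
      simp [mem_powersetCard, subset_inter_iff, and_comm]
    · intro j _ hj
      rw [← sum_filter, filter_false_of_mem, sum_empty, mul_zero]
      rintro J hJ ⟨h1, h2⟩
      have := card_le_card (subset_inter h1 h2)
      rw [(mem_powersetCard.1 hJ).2] at this
      simp only [mem_range] at hj
      omega
  have hexp : ∑ X ∈ S, ∑ Z ∈ S, (b #(X ∪ Z) : ℝ) * (x X * x Z) =
      ∑ j ∈ range (s + 1), (aCoeff s b j : ℝ) *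
        ∑ J ∈ powersetCard j (univ : Finset V), (∑ X ∈ S, if J ⊆ X then x X else 0) ^ 2 := by
    have : ∀ X ∈ S, ∀ Z ∈ S, (b #(X ∪ Z) : ℝ) * (x X * x Z) =
        ∑ j ∈ range (s + 1), ∑ J ∈ powersetCard j (univ : Finset V), (aCoeff s b j : ℝ) *
          ((if J ⊆ X then x X else 0) * (if J ⊆ Z then x Z else 0)) := by
      intro X hX Z hZ
      rw [key X hX Z hZ, sum_mul]
      refine sum_congr rfl fun j _ => ?_
      rw [mul_assoc, sum_mul, mul_sum]
      refine sum_congr rfl fun J _ => ?_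
      split_ifs <;> simp_all
    rw [sum_congr rfl fun X hX => sum_congr rfl (this X hX)]
    simp only [sq, sum_mul_sum]
    rw [sum_congr rfl fun X _ => sum_comm, sum_comm]
    refine sum_congr rfl fun j _ => ?_
    rw [sum_congr rfl fun X _ => sum_comm, sum_comm]
    simp only [mul_sum]
  rw [hexp, sum_range_succ]
  have h1 : 0 ≤ ∑ j ∈ range s, (aCoeff s b j : ℝ) *
      ∑ J ∈ powersetCard j (univ : Finset V), (∑ X ∈ S, if J ⊆ X then x X else 0) ^ 2 :=
    sum_nonneg fun j hj => mul_nonneg (Int.cast_nonneg (ha j (mem_range.1 hj).le))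
      (sum_nonneg fun _ _ => sq_nonneg _)
  -- For j = s, the only member of S containing J ∈ S is J itself.
  have h2 : ∑ X ∈ S, x X ^ 2 ≤
      ∑ J ∈ powersetCard s (univ : Finset V), (∑ X ∈ S, if J ⊆ X then x X else 0) ^ 2 := by
    have hsub : S ⊆ powersetCard s univ := fun X hX =>
      mem_powersetCard.2 ⟨subset_univ _, hS X hX⟩
    refine le_trans (le_of_eq (sum_congr rfl fun J hJ => ?_))
      (sum_le_sum_of_subset_of_nonneg hsub fun _ _ _ => sq_nonneg _)
    congr 1
    rw [sum_eq_single_of_mem J hJ, if_pos subset_rfl]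
    intro X hX hne
    exact if_neg fun h => hne (eq_of_subset_of_card_le h (by rw [hS X hX, hS J hJ])).symm
  have h3 := mul_le_mul_of_nonneg_left h2 (Int.cast_nonneg (R := ℝ) (ha s le_rfl))
  linarith

/-- If the form `∑ x_X x_Z r(X ∪ Z)` is positive definite on `S`, there are at least `|S|`
blocks. -/
theorem card_le_card_blocks {V : Type*} [DecidableEq V] (B : Multiset (Finset V))
    (S : Finset (Finset V))
    (h : ∀ x : Finset V → ℝ,
      ∑ X ∈ S, ∑ Z ∈ S, (blockCount B (X ∪ Z) : ℝ) * (x X * x Z) = 0 → ∀ X ∈ S, x X = 0) :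
    #S ≤ Multiset.card B := by
  rw [← Multiset.card_coe B, ← Fintype.card_coe S]
  -- The incidence map: the form at x is the squared norm of its value, so definiteness makes it
  -- injective.
  let f : (S → ℝ) →ₗ[ℝ] (B → ℝ) :=
    { toFun := fun x y => ∑ X : S, if X.1 ⊆ y.1 then x X else 0
      map_add' := fun x x' => by
        ext y
        simp only [Pi.add_apply, ← sum_add_distrib]
        exact sum_congr rfl fun X _ => by split_ifs <;> simp
      map_smul' := fun c x => by
        ext y
        simp [mul_sum] }
  refine card_le_of_injective ℝ f ((injective_iff_map_eq_zero f).2 fun x hx => ?_)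
  let x' : Finset V → ℝ := fun X => if hX : X ∈ S then x ⟨X, hX⟩ else 0
  have hf : ∀ y : B, ∑ X ∈ S, (if X ⊆ y.1 then x' X else 0) = 0 := by
    intro y
    have := congr_fun hx y
    simp only [f, LinearMap.coe_mk, AddHom.coe_mk, Pi.zero_apply] at this
    rw [← sum_coe_sort S]
    refine Eq.trans ?_ this
    refine sum_congr rfl fun X _ => ?_
    simp [x']
  have hq : ∑ X ∈ S, ∑ Z ∈ S, (blockCount B (X ∪ Z) : ℝ) * (x' X * x' Z) =
      ∑ y : B, (∑ X ∈ S, if X ⊆ y.1 then x' X else 0) ^ 2 := by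
    have : ∀ X ∈ S, ∀ Z ∈ S, (blockCount B (X ∪ Z) : ℝ) * (x' X * x' Z) =
        ∑ y : B, (if X ⊆ y.1 then x' X else 0) * (if Z ⊆ y.1 then x' Z else 0) := by
      intro X _ Z _
      rw [blockCount_eq_sum, Nat.cast_sum, sum_mul]
      refine sum_congr rfl fun y _ => ?_
      by_cases hX : X ⊆ y.1 <;> by_cases hZ : Z ⊆ y.1 <;> simp only [union_subset_iff, hX, hZ] <;>
        simp
    rw [sum_congr rfl fun X hX => sum_congr rfl (this X hX)]
    simp only [sq, sum_mul_sum]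
    rw [sum_congr rfl fun X _ => sum_comm, sum_comm]
  have h0 := h x' (by rw [hq]; simp [hf])
  ext X
  have := h0 X.1 X.2
  simpa [x'] using this

theorem coveringNumber_le {l v k t : ℕ} (ht : 0 < t) (B : Multiset (Finset (Fin v)))
    (hB : IsCovering B t v k l) : coveringNumber l v k t ≤ Multiset.card B := by
  rw [coveringNumber, if_neg ht.ne']
  exact Nat.sInf_le ⟨B, hB, rfl⟩

theorem exists_isCovering (l : ℕ) {v k t : ℕ} (htk : t ≤ k) (hkv : k ≤ v) :
    ∃ B : Multiset (Finset (Fin v)), IsCovering B t v k l := by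
  refine ⟨l • (powersetCard k univ).val, Fintype.card_fin v, ?_, ?_⟩
  · intro Y hY
    exact (mem_powersetCard.1 (Multiset.mem_of_mem_nsmul hY)).2
  · intro T hT
    obtain ⟨Y, hTY, -, hY⟩ := exists_subsuperset_card_eq (subset_univ T) (hT ▸ htk)
      (by simpa using hkv)
    rw [blockCount, Multiset.countP_nsmul]
    exact Nat.le_mul_of_pos_right l
      (Multiset.countP_pos.2 ⟨Y, by simpa using hY, hTY⟩)

/-- The blocks through a set `Z` form a covering on the remaining points. -/
theorem coveringNumber_le_blockCount {V : Type*} [Fintype V] [DecidableEq V]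
    {B : Multiset (Finset V)} {t v k l : ℕ} (hB : IsCovering B t v k l) (Z : Finset V)
    (hZ : #Z ≤ t) : coveringNumber l (v - #Z) (k - #Z) (t - #Z) ≤ blockCount B Z := by
  -- At |Z| = t the convention C_l(v,k,0) = l takes over.
  rcases hZ.eq_or_lt with h | h
  · simp only [coveringNumber, h, Nat.sub_self, if_true]
    exact hB.covers Z h
  have hcard : Fintype.card {x // x ∉ Z} = v - #Z := by
    rw [Fintype.card_subtype_compl, hB.card_points, Fintype.card_coe]
  let e : {x // x ∉ Z} ≃ Fin (v - #Z) := Fintype.equivFinOfCardEq hcard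
  let ι : Fin (v - #Z) ↪ V := e.symm.toEmbedding.trans (Function.Embedding.subtype _)
  let g : Finset V → Finset (Fin (v - #Z)) := fun Y => {j | ι j ∈ Y}
  have hg : ∀ Y, (g Y).map ι = Y \ Z := by
    intro Y
    ext p
    simp only [g, mem_map, mem_filter, mem_univ, true_and, mem_sdiff]
    constructor
    · rintro ⟨j, hj, rfl⟩
      exact ⟨hj, (e.symm j).2⟩
    · rintro ⟨hp, hpZ⟩
      exact ⟨e ⟨p, hpZ⟩, by simpa [ι] using hp, by simp [ι]⟩
  have hcov : IsCovering ((B.filter (Z ⊆ ·)).map g) (t - #Z) (v - #Z) (k - #Z) l := by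
    refine ⟨Fintype.card_fin _, ?_, ?_⟩
    · intro Y' hY'
      obtain ⟨Y, hY, rfl⟩ := Multiset.mem_map.1 hY'
      rw [Multiset.mem_filter] at hY
      rw [← card_map ι, hg, card_sdiff_of_subset hY.2, hB.card_block Y hY.1]
    · intro T hT
      have hd : Disjoint Z (T.map ι) := by
        rw [disjoint_right]
        intro p hp
        obtain ⟨j, -, rfl⟩ := mem_map.1 hp
        exact (e.symm j).2
      have hc := hB.covers (Z ∪ T.map ι) (by
        rw [card_union_of_disjoint hd, card_map, hT]
        omega)
      refine hc.trans (le_of_eq ?_)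
      rw [blockCount, blockCount, Multiset.countP_map, Multiset.filter_filter,
        Multiset.countP_eq_card_filter]
      congr 1
      refine Multiset.filter_congr fun Y _ => ?_
      rw [union_subset_iff, and_comm]
      refine and_congr ?_ Iff.rfl
      simp only [g, subset_iff, mem_map, mem_filter, mem_univ, true_and,
        forall_exists_index, and_imp, forall_apply_eq_imp_iff₂]
  refine (coveringNumber_le (by omega) _ hcov).trans (le_of_eq ?_)
  rw [Multiset.card_map, blockCount, Multiset.countP_eq_card_filter]

end Coverings

/-! ### Parameter inequalities, the excess multigraph and the rank bound -/

section Parameters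

open Finset

variable {t v k l s : ℕ} {b : ℕ → ℕ}

/-- Product of the inequalities (v - i) b_{i+1} ≤ (k - i) b_i from i = s on, divided by m!. -/
theorem SetUp.mul_choose_le (h : SetUp t v k l s b) {m : ℕ} (hm : m ≤ s) :
    b (s + m) * (v - s).choose m ≤ b s * (k - s).choose m := by
  have hs := h.s_le
  have htk := h.t_lt_k
  have hkv := h.k_lt_v
  induction m with
  | zero => simp
  | succ m ih =>
    have ih := ih (by omega)
    have h1 : (v - (s + m)) * b (s + m + 1) ≤ (k - (s + m)) * b (s + m) := by
      have hk : (0 : ℚ) < ((k - (s + m) : ℕ) : ℚ) := by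
        exact_mod_cast (by omega : 0 < k - (s + m))
      have h2 := Nat.le_of_ceil_le (h.step_lower (s + m) (by omega) (by omega))
      rw [div_mul_eq_mul_div, div_le_iff₀ hk] at h2
      rw [mul_comm (k - (s + m))]
      exact_mod_cast h2
    rw [← Nat.sub_sub, ← Nat.sub_sub] at h1
    refine Nat.le_of_mul_le_mul_right (c := m + 1) ?_ m.succ_pos
    rw [mul_assoc, mul_assoc, Nat.choose_succ_right_eq, Nat.choose_succ_right_eq]
    calc b (s + (m + 1)) * ((v - s).choose m * (v - s - m))
        = (v - s).choose m * ((v - s - m) * b (s + m + 1)) := by rw [← add_assoc]; ring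
      _ ≤ (v - s).choose m * ((k - s - m) * b (s + m)) := Nat.mul_le_mul_left _ h1
      _ = b (s + m) * (v - s).choose m * (k - s - m) := by ring
      _ ≤ b s * (k - s).choose m * (k - s - m) := Nat.mul_le_mul_right _ ih
      _ = _ := by ring

/-- Vandermonde expands binom(k,s) - 1 into terms that dominate the subtracted sum one by one. -/
theorem SetUp.dParam_nonneg (h : SetUp t v k l s b) : 0 ≤ dParam v k s b := by
  have hs := h.s_le
  have htk := h.t_lt_k
  have vand : k.choose s = ∑ i ∈ range s, s.choose i * (k - s).choose (s - i) + 1 := by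
    conv_lhs => rw [← Nat.add_sub_cancel' (show s ≤ k by omega)]
    rw [Nat.add_choose_eq,
      Finset.Nat.sum_antidiagonal_eq_sum_range_succ (fun i j => s.choose i * (k - s).choose j),
      sum_range_succ]
    simp
  rw [dParam, vand, sub_nonneg]
  push_cast
  rw [add_sub_cancel_right, mul_sum]
  refine sum_le_sum fun i hi => ?_
  have hi := mem_range.1 hi
  have h1 := h.mul_choose_le (m := s - i) (by omega)
  rw [show s + (s - i) = 2 * s - i by omega] at h1
  have h2 := Nat.mul_le_mul_left (s.choose i) h1
  zify at h2
  linarith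

/-- In Newton's expansion of b_s all terms are nonnegative; j = s gives a_s and j = 0 gives b_{2s} ≥
1. -/
theorem SetUp.aCoeff_lt (h : SetUp t v k l s b) : aCoeff s b s + 1 ≤ b s := by
  have h1 := sum_choose_mul_aCoeff s b s
  obtain ⟨m, hm⟩ : ∃ m, s = m + 1 := ⟨s - 1, by have := h.s_pos; omega⟩
  rw [show 2 * s - s = s by omega, sum_range_succ] at h1
  have h2 : aCoeff s b 0 ≤ ∑ j ∈ range s, (s.choose j : ℤ) * aCoeff s b j := by
    have := single_le_sum (f := fun j => (s.choose j : ℤ) * aCoeff s b j) (s := range s)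
      (fun j hj => mul_nonneg (Int.natCast_nonneg _) (h.a_nonneg j (mem_range.1 hj).le))
      (mem_range.2 h.s_pos)
    simpa using this
  have h3 : aCoeff s b 0 = b (2 * s) := by simp [aCoeff]
  have h4 := h.b_pos (2 * s) (by omega) le_rfl
  simp only [Nat.choose_self, Nat.cast_one, one_mul] at h1
  omega

theorem SetUp.le_blockCount (h : SetUp t v k l s b) {V : Type*} [Fintype V] [DecidableEq V]
    {B : Multiset (Finset V)} (hB : IsCovering B t v k l) {Z : Finset V} (h1 : s ≤ #Z)
    (h2 : #Z ≤ 2 * s) : b #Z ≤ blockCount B Z := by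
  have hs := h.s_le
  refine le_trans ?_ (coveringNumber_le_blockCount hB Z (by omega))
  rcases h2.eq_or_lt with h3 | h3
  · rw [h3]
    exact h.top_upper
  · exact h.step_upper _ h1 h3

/-- The off-diagonal excess of `r(X ∪ Z)` over `b (|X ∪ Z|)`. -/
def excess {V : Type*} [DecidableEq V] (B : Multiset (Finset V)) (b : ℕ → ℕ) (X Z : Finset V) :
    ℕ :=
  if X = Z then 0 else blockCount B (X ∪ Z) - b #(X ∪ Z)

theorem excess_comm {V : Type*} [DecidableEq V] (B : Multiset (Finset V)) (b : ℕ → ℕ)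
    (X Z : Finset V) : excess B b X Z = excess B b Z X := by
  simp only [excess, union_comm X Z, eq_comm]

theorem excess_self {V : Type*} [DecidableEq V] (B : Multiset (Finset V)) (b : ℕ → ℕ)
    (X : Finset V) : excess B b X X = 0 := if_pos rfl

variable {V : Type*} [Fintype V] [DecidableEq V] {B : Multiset (Finset V)}

/-- Since r ≥ b on all sizes from s to 2s, the natural subtractions do not truncate. -/
theorem SetUp.blockCount_union (h : SetUp t v k l s b) (hB : IsCovering B t v k l)
    {X Z : Finset V} (hX : #X = s) (hZ : #Z = s) :
    blockCount B (X ∪ Z) =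
      b #(X ∪ Z) + excess B b X Z + if X = Z then blockCount B X - b s else 0 := by
  have h1 : s ≤ #(X ∪ Z) := hX ▸ card_le_card subset_union_left
  have h2 : #(X ∪ Z) ≤ 2 * s := by
    have := card_union_le X Z
    omega
  have h3 := h.le_blockCount hB h1 h2
  by_cases hXZ : X = Z
  · subst hXZ
    simp only [union_self, hX, excess_self, if_true] at h3 ⊢
    omega
  · simp only [excess, hXZ, if_false]
    omega

/-- The origin of d and d': the row sum of r(X ∪ Z) is r(X) binom(k,s), and the row sum of b is
found by sorting Z by |X ∩ Z|. -/
theorem SetUp.sum_excess (h : SetUp t v k l s b) (hB : IsCovering B t v k l)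
    {X : Finset V} (hX : #X = s) :
    (∑ Z ∈ powersetCard s univ, excess B b X Z : ℤ) =
      dParam v k s b + (blockCount B X - b s) * ((k.choose s : ℤ) - 1) := by
  have hXm : X ∈ powersetCard s univ := mem_powersetCard.2 ⟨subset_univ _, hX⟩
  have hr := h.le_blockCount hB (Z := X) hX.ge (by omega)
  rw [hX] at hr
  have h1 := sum_blockCount_union B hB.card_block s X
  rw [sum_congr rfl fun Z hZ => h.blockCount_union hB hX (mem_powersetCard.1 hZ).2,
    sum_add_distrib, sum_add_distrib, sum_ite_eq, if_pos hXm] at h1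
  have h2 : ∑ Z ∈ powersetCard s univ, b #(X ∪ Z) =
      ∑ i ∈ range s, s.choose i * (v - s).choose (s - i) * b (2 * s - i) + b s := by
    have := sum_comp_card_inter X s (fun i => b (2 * s - i))
    rw [hX, hB.card_points, sum_range_succ] at this
    simp only [Nat.choose_self, Nat.sub_self, Nat.choose_zero_right, one_mul,
      show 2 * s - s = s by omega] at this
    rw [← this]
    refine sum_congr rfl fun Z hZ => ?_
    congr 1
    have := card_union_add_card_inter X Z
    have := (mem_powersetCard.1 hZ).2
    omega
  rw [h2] at h1
  zify [hr] at h1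
  rw [dParam]
  linarith

theorem SetUp.degIn_excess_le (h : SetUp t v k l s b) (hB : IsCovering B t v k l)
    {V₀ V₁ : Finset (Finset V)} (h0 : ∀ X ∈ V₀, #X = s) (h1 : ∀ X ∈ V₁, #X = s)
    (hd : Disjoint V₀ V₁) {X : Finset V} (hX : #X = s) :
    degIn (excess B b) X V₀ + degIn (excess B b) X V₁ ≤
      dParam v k s b + (blockCount B X - b s) * ((k.choose s : ℝ) - 1) := by
  have h2 := h.sum_excess hB hX
  have h3 : (∑ Z ∈ powersetCard s univ, excess B b X Z : ℝ) =
      dParam v k s b + (blockCount B X - b s) * ((k.choose s : ℝ) - 1) := by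
    exact_mod_cast congrArg (Int.cast : ℤ → ℝ) h2
  rw [← h3, degIn, degIn, ← sum_union hd]
  refine sum_le_sum_of_subset_of_nonneg (fun Z hZ => ?_) fun _ _ _ => Nat.cast_nonneg _
  rw [mem_powersetCard]
  rcases mem_union.1 hZ with hZ | hZ
  exacts [⟨subset_univ _, h0 Z hZ⟩, ⟨subset_univ _, h1 Z hZ⟩]

/-- The rank bound for a sparse set of `s`-sets lying in `b_s` or `b_s + 1` blocks. -/
theorem SetUp.card_add_card_le (h : SetUp t v k l s b) (hB : IsCovering B t v k l)
    (hda : dParam v k s b < aCoeff s b s)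
    {V₀ T : Finset (Finset V)} (h0 : ∀ X ∈ V₀, #X = s ∧ blockCount B X = b s)
    (h1 : ∀ X ∈ T, #X = s ∧ blockCount B X = b s + 1)
    (hsparse : ∀ X ∈ T, degIn (excess B b) X T +
      (dParam v k s b : ℝ) / aCoeff s b s * degIn (excess B b) X V₀ < aCoeff s b s + 1) :
    #V₀ + #T ≤ Multiset.card B := by
  have hdisj : Disjoint V₀ T := disjoint_left.2 fun X hX hX' => by
    have := (h0 X hX).2
    have := (h1 X hX').2
    omega
  have hd0 : (0 : ℝ) ≤ dParam v k s b := by exact_mod_cast h.dParam_nonneg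
  have hda' : (dParam v k s b : ℝ) + 1 ≤ aCoeff s b s := by exact_mod_cast hda
  set a : ℝ := (aCoeff s b s : ℝ) with ha
  set d : ℝ := (dParam v k s b : ℝ) with hd
  have ha0 : 0 < a := by linarith
  -- At weight d/a the rows of V₀ are in general only weakly dominant, and the weight vanishes if d
  -- = 0. The finitely many strict inequalities on `T` leave room for ε.
  obtain ⟨ε, hε, hε1, hsp⟩ : ∃ ε > 0, d / a + ε ≤ 1 ∧ ∀ X ∈ T,
      degIn (excess B b) X T + (d / a + ε) * degIn (excess B b) X V₀ < a + 1 := by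
    have hev : ∀ᶠ ε : ℝ in nhdsWithin 0 (Set.Ioi 0), d / a + ε ≤ 1 ∧ ∀ X ∈ T,
        degIn (excess B b) X T + (d / a + ε) * degIn (excess B b) X V₀ < a + 1 := by
      refine Filter.Eventually.filter_mono nhdsWithin_le_nhds (Filter.Eventually.and ?_ ?_)
      · have hc : ContinuousAt (fun ε : ℝ => d / a + ε) 0 := by fun_prop
        have : (fun ε : ℝ => d / a + ε) 0 < 1 := by
          simp only [add_zero]
          rw [div_lt_one ha0]
          linarith
        exact (hc.eventually_lt continuousAt_const this).mono fun _ => le_of_lt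
      · rw [Filter.eventually_all_finset]
        intro X hX
        have hc : ContinuousAt (fun ε : ℝ => degIn (excess B b) X T +
          (d / a + ε) * degIn (excess B b) X V₀) 0 := by fun_prop
        exact hc.eventually_lt continuousAt_const (by simpa using hsparse X hX)
    obtain ⟨ε, h1, h2⟩ := (hev.and self_mem_nhdsWithin).exists
    exact ⟨ε, h2, h1⟩
  have hyp : 0 < d / a + ε := by positivity
  have hS : ∀ X ∈ V₀ ∪ T, #X = s := fun X hX =>
    (mem_union.1 hX).elim (fun hX => (h0 X hX).1) fun hX => (h1 X hX).1
  have hTV : ∀ X ∈ T, X ∉ V₀ := fun X hX hX' => disjoint_left.1 hdisj hX' hX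
  rw [← card_union_of_disjoint hdisj]
  refine card_le_card_blocks B _ fun x hx => ?_
  refine eq_zero_of_dominant (excess B b) (excess_comm B b) _
    (fun X => a + (blockCount B X - b s)) (fun X => if X ∈ V₀ then d / a + ε else 1) ?_ ?_ x ?_
  · intro X _
    split_ifs <;> linarith
  · intro X hX
    have hsum : ∑ Z ∈ V₀ ∪ T, (excess B b X Z : ℝ) * (if Z ∈ V₀ then d / a + ε else 1) =
        (d / a + ε) * degIn (excess B b) X V₀ + degIn (excess B b) X T := by
      rw [sum_union hdisj, degIn, degIn, mul_sum]
      congr 1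
      · exact sum_congr rfl fun Z hZ => by rw [if_pos hZ, mul_comm]
      · exact sum_congr rfl fun Z hZ => by rw [if_neg (hTV Z hZ), mul_one]
    rw [hsum]
    rcases mem_union.1 hX with hX | hX
    · have h2 := h.degIn_excess_le hB (fun X hX => (h0 X hX).1) (fun X hX => (h1 X hX).1) hdisj
        (h0 X hX).1
      rw [(h0 X hX).2, sub_self, zero_mul, add_zero] at h2
      rw [(h0 X hX).2, if_pos hX, sub_self, add_zero]
      -- Weights are at most 1, so a row of V₀ sums to at most d < a (d/a + ε).
      have h3 := mul_le_mul_of_nonneg_right hε1 (degIn_nonneg (excess B b) X V₀)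
      have h4 : a * (d / a + ε) = d + a * ε := by field_simp
      have h5 := mul_pos ha0 hε
      linarith
    · rw [(h1 X hX).2, if_neg (hTV X hX)]
      push_cast
      have := hsp X hX
      linarith
  · have h2 := aCoeff_mul_sum_sq_le b h.a_nonneg (V₀ ∪ T) hS x
    have h3 : ∑ X ∈ V₀ ∪ T, ∑ Z ∈ V₀ ∪ T, (blockCount B (X ∪ Z) : ℝ) * (x X * x Z) =
        ∑ X ∈ V₀ ∪ T, ∑ Z ∈ V₀ ∪ T, (b #(X ∪ Z) : ℝ) * (x X * x Z) +
        ∑ X ∈ V₀ ∪ T, ∑ Z ∈ V₀ ∪ T, (excess B b X Z : ℝ) * (x X * x Z) +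
        ∑ X ∈ V₀ ∪ T, ((blockCount B X : ℝ) - b s) * x X ^ 2 := by
      rw [← sum_add_distrib, ← sum_add_distrib]
      refine sum_congr rfl fun X hX => ?_
      have hr := h.le_blockCount hB (Z := X) (hS X hX).ge (by rw [hS X hX]; omega)
      rw [hS X hX] at hr
      have : ∑ Z ∈ V₀ ∪ T, (if X = Z then ((blockCount B X : ℝ) - b s) else 0) * (x X * x Z) =
          ((blockCount B X : ℝ) - b s) * x X ^ 2 := by
        simp only [ite_mul, zero_mul, sum_ite_eq, if_pos hX]
        ring
      rw [← this, ← sum_add_distrib, ← sum_add_distrib]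
      refine sum_congr rfl fun Z hZ => ?_
      rw [h.blockCount_union hB (hS X hX) (hS Z hZ)]
      split_ifs
      · push_cast [Nat.cast_sub hr]
        ring
      · push_cast
        ring
    rw [hx] at h3
    simp only [add_mul, sum_add_distrib, ← mul_sum]
    linarith

/-- In (α - β) · `hcount` + `hrank` both n₀ and n₁ get the coefficient -(α - 2β), so only n₀ + n₁
matters. -/
theorem CB_le {v k s bs : ℕ} {α β n n₀ n₁ : ℝ} (hα : 0 ≤ α) (hαβ : 2 * β ≤ α)
    (hN : n₀ + n₁ ≤ v.choose s)
    (hcount : (bs + 2) * (v.choose s : ℝ) - 2 * n₀ - n₁ ≤ n * k.choose s)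
    (hrank : α * n₀ + β * n₁ ≤ n) : CB v k s bs α β ≤ n := by
  have h1 : 0 ≤ α - β := by linarith
  have hC : (0 : ℝ) ≤ k.choose s := Nat.cast_nonneg _
  rw [CB, div_le_iff₀ (by positivity)]
  have h2 := mul_le_mul_of_nonneg_left hcount h1
  have h3 := mul_nonneg (sub_nonneg.2 hαβ) (sub_nonneg.2 hN)
  linarith

/-- The counting half of the bound: the rank inequality `α n₀ + β n₁ ≤ |B|` suffices. -/
theorem SetUp.CB_le_card (h : SetUp t v k l s b) (hB : IsCovering B t v k l) {α β : ℝ}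
    (hα : 0 ≤ α) (hαβ : 2 * β ≤ α)
    (hrank : α * #{X ∈ powersetCard s (univ : Finset V) | blockCount B X = b s} +
      β * #{X ∈ powersetCard s (univ : Finset V) | blockCount B X = b s + 1} ≤
        Multiset.card B) :
    CB v k s (b s) α β ≤ Multiset.card B := by
  have hW : #(powersetCard s (univ : Finset V)) = v.choose s := by
    rw [card_powersetCard, card_univ, hB.card_points]
  refine CB_le hα hαβ ?_ ?_ hrank
  · rw [← hW]
    have hd : Disjoint {X ∈ powersetCard s (univ : Finset V) | blockCount B X = b s}
        {X ∈ powersetCard s (univ : Finset V) | blockCount B X = b s + 1} :=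
      disjoint_filter.2 fun X _ h1 h2 => by omega
    rw [← Nat.cast_add, ← card_union_of_disjoint hd, ← filter_or]
    exact_mod_cast card_filter_le _ _
  · have h1 := sum_blockCount_union B hB.card_block s ∅
    simp only [empty_union, blockCount_empty] at h1
    have h2 : ∀ X ∈ powersetCard s (univ : Finset V), b s + 2 ≤ blockCount B X +
        2 * (if blockCount B X = b s then 1 else 0) +
        (if blockCount B X = b s + 1 then 1 else 0) := by
      intro X hX
      have hXs := (mem_powersetCard.1 hX).2
      have := h.le_blockCount hB (Z := X) hXs.ge (by omega)
      rw [hXs] at this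
      split_ifs <;> omega
    have h3 := sum_le_sum h2
    rw [sum_const, sum_add_distrib, sum_add_distrib, h1, ← mul_sum, ← card_filter,
      ← card_filter, hW, smul_eq_mul] at h3
    have h4 : ((v.choose s * (b s + 2) : ℕ) : ℝ) ≤ ((_ : ℕ) : ℝ) := Nat.cast_le.2 h3
    push_cast at h4
    linarith

end Parameters

/-! ### The three choices of (α, β) -/

theorem theorem6p3 (t v k l s : ℕ) (b : ℕ → ℕ) (h : SetUp t v k l s b)
    (hbs : b s < k.choose s)
    (a d d' : ℤ) (ha : a = aCoeff s b s) (hd : d = dParam v k s b)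
    (hd' : d' = d + (k.choose s : ℤ) - 1) (hda : d < a)
    (α β : ℝ)
    (hαβ :
      -- choice (a)
      (α = 1 - (d : ℝ) ^ 2 / (2 * a * (a + 1)) ∧ β = ((a : ℝ) + 2) / (2 * (d' + 1)))
      ∨
      -- choice (b)
      (α = 1 ∧ β = 1 - (d : ℝ) * d' / (a * (a + 1)) ∧
        (a : ℝ) / 2 ≤ d ∧ d * d' < a * (a + 1))
      ∨
      -- choice (c)
      (α = 1 ∧
        β = Real.sqrt ((d : ℝ) * (a + 2) / ((a + 1) * (a - d)))
          - (d : ℝ) * (d' + 1) / (2 * (a + 1) * (a - d)) ∧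
        (d : ℝ) < (a : ℝ) / 2 ∧
        d * (d' + 1) ^ 2 < 4 * (a + 1) * (a + 2) * (a - d))) :
    ⌈CB v k s (b s) α β⌉ ≤ (coveringNumber l v k t : ℤ) := by
  have ht := h.t_pos
  -- Existence of a covering makes `sInf` an attained minimum rather than the default 0 of the empty
  -- set.
  obtain ⟨B, hB, hcard⟩ : ∃ B : Multiset (Finset (Fin v)), IsCovering B t v k l ∧
      Multiset.card B = coveringNumber l v k t := by
    obtain ⟨B, hB⟩ := exists_isCovering l h.t_lt_k.le h.k_lt_v.le
    rw [coveringNumber, if_neg ht.ne']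
    exact Nat.sInf_mem (s := {n : ℕ | ∃ B : Multiset (Finset (Fin v)),
      IsCovering B t v k l ∧ Multiset.card B = n}) ⟨_, B, hB, rfl⟩
  rw [← hcard, Int.ceil_le, Int.cast_natCast]
  have hd0 : 0 ≤ d := hd ▸ h.dParam_nonneg
  have hab : a + 1 ≤ b s := ha ▸ h.aCoeff_lt
  -- From `hbs` and a_s < b_s. This puts d' beyond the break a_s + 1 of the weight and yields 2β ≤ α
  -- in all three cases.
  have hd'a : d + a + 1 ≤ d' := by omega
  have hda1 : d + 1 ≤ a := hda
  have hbsC : (b s : ℤ) + 1 ≤ k.choose s := by exact_mod_cast hbs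
  set V₀ : Finset (Finset (Fin v)) :=
    {X ∈ Finset.powersetCard s Finset.univ | blockCount B X = b s} with hV₀
  set V₁ : Finset (Finset (Fin v)) :=
    {X ∈ Finset.powersetCard s Finset.univ | blockCount B X = b s + 1} with hV₁
  have m0 : ∀ X ∈ V₀, X.card = s ∧ blockCount B X = b s := fun X hX => by
    rw [hV₀, Finset.mem_filter, Finset.mem_powersetCard] at hX
    exact ⟨hX.1.2, hX.2⟩
  have m1 : ∀ X ∈ V₁, X.card = s ∧ blockCount B X = b s + 1 := fun X hX => by
    rw [hV₁, Finset.mem_filter, Finset.mem_powersetCard] at hX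
    exact ⟨hX.1.2, hX.2⟩
  have hdisj : Disjoint V₀ V₁ := Finset.disjoint_filter.2 fun X _ h1 h2 => by omega
  have deg (X : Finset (Fin v)) (hX : X.card = s) := h.degIn_excess_le hB
    (fun X hX => (m0 X hX).1) (fun X hX => (m1 X hX).1) hdisj hX
  have deg0 : ∀ X ∈ V₀, degIn (excess B b) X V₁ ≤ d := fun X hX => by
    have h1 := deg X (m0 X hX).1
    rw [(m0 X hX).2, sub_self, zero_mul, add_zero, ← hd] at h1
    linarith [degIn_nonneg (excess B b) X V₀]
  have deg1 : ∀ X ∈ V₁, degIn (excess B b) X V₀ + degIn (excess B b) X V₁ ≤ d' := fun X hX => by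
    have h1 := deg X (m1 X hX).1
    rw [(m1 X hX).2, ← hd] at h1
    refine h1.trans (le_of_eq ?_)
    rw [hd']
    push_cast
    ring
  have rank (T : Finset (Finset (Fin v))) (hT : T ⊆ V₁) (hsp : ∀ X ∈ T,
      degIn (excess B b) X T + (d : ℝ) / a * degIn (excess B b) X V₀ < a + 1) :
      (V₀.card : ℝ) + T.card ≤ Multiset.card B := by
    subst ha hd
    exact_mod_cast h.card_add_card_le hB hda m0 (fun X hX => m1 X (hT hX)) hsp
  have hd0' : (0 : ℝ) ≤ d := by exact_mod_cast hd0
  have hda' : (d : ℝ) + 1 ≤ a := by exact_mod_cast hda1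
  have hd'a' : (d : ℝ) + a + 1 ≤ d' := by exact_mod_cast hd'a
  clear_value V₀ V₁
  generalize (a : ℝ) = a at *
  generalize (d : ℝ) = d at *
  generalize (d' : ℝ) = d' at *
  have ha0 : 0 < a := by linarith
  suffices 0 ≤ α ∧ 2 * β ≤ α ∧ α * V₀.card + β * V₁.card ≤ Multiset.card B by
    subst hV₀ hV₁
    exact h.CB_le_card hB this.1 this.2.1 this.2.2
  rcases hαβ with ⟨rfl, rfl⟩ | ⟨rfl, rfl, hda2, -⟩ | ⟨rfl, rfl, hda2, -⟩
  · have hα2 : 2 * ((a + 2) / (2 * (d' + 1))) ≤ 1 - d ^ 2 / (2 * a * (a + 1)) := by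
      have h1 : 2 * ((a + 2) / (2 * (d' + 1))) ≤ (a + 2) / (d + a + 2) := by
        have hd'1 : 0 < d' + 1 := by linarith
        calc 2 * ((a + 2) / (2 * (d' + 1))) = (a + 2) / (d' + 1) := by field_simp
          _ ≤ _ := div_le_div_of_nonneg_left (by linarith) (by linarith) (by linarith)
      have h2 : (a + 2) / (d + a + 2) = 1 - d / (d + a + 2) := by
        field_simp
        ring
      have h3 : d ^ 2 / (2 * a * (a + 1)) ≤ d / (d + a + 2) := by
        rw [div_le_div_iff₀ (by positivity) (by positivity)]
        have : d * (d + a + 2) ≤ 2 * a * (a + 1) := by nlinarith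
        nlinarith
      linarith
    have hβ : 0 ≤ (a + 2) / (2 * (d' + 1)) := by
      have : 0 < d' + 1 := by linarith
      positivity
    refine ⟨by linarith, hα2, ?_⟩
    obtain ⟨T, hT, hsp, hb⟩ := exists_sparse_caroTuza (excess B b) (excess_comm B b)
      (excess_self B b) V₀ V₁ ha0 hd0'
    refine le_trans ?_ (rank T hT hsp)
    have h1 : ∀ X ∈ V₁, (a + 2) / (2 * (d' + 1)) ≤
        caroTuza (a + 1) (degIn (excess B b) X V₁ + d / a * degIn (excess B b) X V₀) := by
      intro X hX
      have h2 := caroTuza_of_ge (j := a + 1) (x := d') (by linarith) (by linarith)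
      rw [show a + 1 + 1 = a + 2 by ring] at h2
      rw [← h2]
      apply caroTuza_antitone (by linarith)
      have h3 := deg1 X hX
      have h4 : d / a ≤ 1 := by
        rw [div_le_one ha0]
        linarith
      have := mul_le_mul_of_nonneg_right h4 (degIn_nonneg (excess B b) X V₀)
      linarith
    have h2 := Finset.sum_le_sum h1
    rw [Finset.sum_const, nsmul_eq_mul] at h2
    rw [Finset.sum_sub_distrib, ← Finset.mul_sum] at hb
    -- Counted from V₀, where degrees are at most d, the edges between V₀ and V₁ incur a total
    -- penalty of at most (1 - α)|V₀|.
    have h3 : ∑ X ∈ V₁, degIn (excess B b) X V₀ = ∑ X ∈ V₀, degIn (excess B b) X V₁ := by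
      simp only [degIn]
      rw [Finset.sum_comm]
      simp only [excess_comm B b]
    have h4 : ∑ X ∈ V₀, degIn (excess B b) X V₁ ≤ V₀.card * d := by
      simpa using Finset.sum_le_sum deg0
    rw [h3] at hb
    have h5 := mul_le_mul_of_nonneg_left h4
      (show 0 ≤ d / (2 * a * (a + 1)) by positivity)
    have h6 : d / (2 * a * (a + 1)) * (V₀.card * d) =
        d ^ 2 / (2 * a * (a + 1)) * V₀.card := by ring
    linarith
  · refine ⟨zero_le_one, ?_, ?_⟩
    · have : 1 / 2 ≤ d * d' / (a * (a + 1)) := by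
        rw [div_le_div_iff₀ (by positivity) (by positivity)]
        nlinarith
      linarith
    · obtain ⟨T, hT, hsp, hb⟩ := exists_sparse_linear (excess B b) (excess_comm B b)
        (excess_self B b) V₀ V₁ ha0 hda2 deg1
      have := rank T hT hsp
      linarith
  · refine ⟨zero_le_one, ?_, ?_⟩
    · have h1 := caroTuza_sub_ge (d' := d') ha0 hd0' hda2 le_rfl
        (show 0 ≤ d' by linarith) (by linarith)
      have h2 : caroTuza (a + 1) (d' + d / a * 0) ≤ 1 / 2 := by
        rw [mul_zero, add_zero, caroTuza_of_ge (by linarith) (by linarith),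
          div_le_div_iff₀ (by linarith) (by norm_num)]
        linarith
      linarith
    · obtain ⟨T, hT, hsp, hb⟩ := exists_sparse_caroTuza (excess B b) (excess_comm B b)
        (excess_self B b) V₀ V₁ ha0 hd0'
      have h1 := Finset.sum_le_sum fun X hX => caroTuza_sub_ge ha0 hd0' hda2
        (degIn_nonneg (excess B b) X V₀) (degIn_nonneg (excess B b) X V₁) (deg1 X hX)
      rw [Finset.sum_const, nsmul_eq_mul] at h1
      have := rank T hT hsp
      linarith
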